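/- For $n\in\mathbb N$ let $C(S^1)^{(n)}\subseteq M_n(\mathbb C)$ be the operator system of all $n\times n$ complex Toeplitz matrices, with order unit the identity matrix $1_n$ and matrix cones $M_k(C(S^1)^{(n)})_+$ inherited from $M_k(M_n(\mathbb C))=M_{kn}(\mathbb C)$. The positive cone of the maximal tensor product $C(S^1)^{(n)}\otimes_{\max}C(S^1)^{(m)}$ consists of those $x$ in the algebraic tensor product such that for every $\varepsilon>0$ there are $k,q\in\mathbb N$, $a\in M_k(C(S^1)^{(n)})_+$, $b\in M_q(C(S^1)^{(m)})_+$ and a linear map $\delta:\mathbb C\to\mathbb C^k\otimes\mathbb C^q$ with $\varepsilon(1_n\otimes 1_m)+x=\delta^*(a\otimes b)\delta$. An element $x$ of this cone is strictly positive if $x-c\,(1_n\otimes 1_m)$ is in the cone for some real $c>0$, and separable if $x=\sum_{j=1}^N r_j\otimes s_j$ for some $N$, positive semidefinite $r_1,\dots,r_N\in C(S^1)^{(n)}$ and positive semidefinite $s_1,\dots,s_N\in C(S^1)^{(m)}$. Proposition. If $x$ is strictly positive in $C(S^1)^{(n)}\otimes_{\max}C(S^1)^{(m)}$, then $x$ is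 separable. -/

import Mathlib

open scoped TensorProduct ComplexOrder Matrix

/-- An operator system of `n × n` complex matrices: a linear subspace of `M_n(ℂ)` that is closed
under the adjoint and contains the identity matrix (its Archimedean order unit). -/
structure MatrixOperatorSystem (n : ℕ) where
  /-- The underlying vector space. -/
  space : Submodule ℂ (Matrix (Fin n) (Fin n) ℂ)
  one_mem : (1 : Matrix (Fin n) (Fin n) ℂ) ∈ space
  conjTranspose_mem : ∀ A ∈ space, Aᴴ ∈ space

namespace MatrixOperatorSystem

variable {n m : ℕ}

/-- The order unit of an operator system of matrices: the identity matrix. -/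
def unit (S : MatrixOperatorSystem n) : S.space := ⟨1, S.one_mem⟩

/-- Positivity of an element: positive semidefiniteness as a matrix. -/
def IsPositive (S : MatrixOperatorSystem n) (s : S.space) : Prop :=
  (s : Matrix (Fin n) (Fin n) ℂ).PosSemidef

/-- The cone `M_p(S)_+`: a `p × p` matrix over `S ⊆ M_n(ℂ)` is positive if it is positive
semidefinite as an element of `M_p(M_n(ℂ)) = M_{pn}(ℂ)`. -/
def IsMatrixPositive (S : MatrixOperatorSystem n) {p : ℕ} (a : Matrix (Fin p) (Fin p) S.space) :
    Prop :=
  (Matrix.comp (Fin p) (Fin p) (Fin n) (Fin n) ℂ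
    (a.map fun s => (s : Matrix (Fin n) (Fin n) ℂ))).PosSemidef

/-- For `a ∈ M_k(S)`, `b ∈ M_q(T)`, the matrix `a ⊗ b ∈ M_{kq}(S ⊗ T)` with entries
`a i j ⊗ b i' j'`. -/
def matrixTmul (S : MatrixOperatorSystem n) (T : MatrixOperatorSystem m) {k q : ℕ}
    (a : Matrix (Fin k) (Fin k) S.space) (b : Matrix (Fin q) (Fin q) T.space) :
    Matrix (Fin k × Fin q) (Fin k × Fin q) (S.space ⊗[ℂ] T.space) :=
  Matrix.kroneckerMap (fun s t => s ⊗ₜ[ℂ] t) a b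

/-- The matrix `δ* y δ` for a scalar matrix `δ` and a matrix `y` over a complex vector space. -/
def compress {V : Type*} [AddCommGroup V] [Module ℂ V] {ι κ : Type*} [Fintype ι]
    (δ : Matrix ι κ ℂ) (y : Matrix ι ι V) : Matrix κ κ V :=
  Matrix.of fun i j => ∑ k, ∑ l, (star (δ k i) * δ l j) • y k l

/-- The cone `M_p(S ⊗_max T)_+` of the maximal operator system tensor product, on the algebraic
tensor product of `S` and `T`: for every `ε > 0`, the matrix `ε (e_S ⊗ e_T) + x` has the form
`δ* (a ⊗ b) δ` with `a ∈ M_k(S)_+`, `b ∈ M_q(T)_+` and `δ : ℂ^p → ℂ^k ⊗ ℂ^q` linear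
(given by its matrix). -/
def IsMaxMatrixPositive (S : MatrixOperatorSystem n) (T : MatrixOperatorSystem m) {p : ℕ}
    (x : Matrix (Fin p) (Fin p) (S.space ⊗[ℂ] T.space)) : Prop :=
  ∀ ε : ℝ, 0 < ε → ∃ (k q : ℕ) (a : Matrix (Fin k) (Fin k) S.space)
    (b : Matrix (Fin q) (Fin q) T.space) (δ : Matrix (Fin k × Fin q) (Fin p) ℂ),
    S.IsMatrixPositive a ∧ T.IsMatrixPositive b ∧
      (Matrix.diagonal fun _ => (ε : ℂ) • (S.unit ⊗ₜ[ℂ] T.unit)) + x =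
        compress δ (matrixTmul S T a b)

/-- The positive cone of `S ⊗_max T`, an element being regarded as a `1 × 1` matrix. -/
def IsMaxPositive (S : MatrixOperatorSystem n) (T : MatrixOperatorSystem m)
    (x : S.space ⊗[ℂ] T.space) : Prop :=
  IsMaxMatrixPositive S T (Matrix.of fun _ _ : Fin 1 => x)

/-- Strict positivity in `S ⊗_max T`: `x` is positive and `x - δ (e_S ⊗ e_T)` is positive for
some real `δ > 0`. -/
def IsMaxStrictlyPositive (S : MatrixOperatorSystem n) (T : MatrixOperatorSystem m)
    (x : S.space ⊗[ℂ] T.space) : Prop :=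
  IsMaxPositive S T x ∧
    ∃ δ : ℝ, 0 < δ ∧ IsMaxPositive S T (x - (δ : ℂ) • (S.unit ⊗ₜ[ℂ] T.unit))

/-- Separability in `S ⊗_max T`: `x` lies in the positive cone and is a finite sum of elementary
tensors of positive elements. -/
def IsMaxSeparable (S : MatrixOperatorSystem n) (T : MatrixOperatorSystem m)
    (x : S.space ⊗[ℂ] T.space) : Prop :=
  IsMaxPositive S T x ∧
    ∃ (N : ℕ) (r : Fin N → S.space) (s : Fin N → T.space),
      (∀ j, S.IsPositive (r j)) ∧ (∀ j, T.IsPositive (s j)) ∧ x = ∑ j, r j ⊗ₜ[ℂ] s j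

end MatrixOperatorSystem

/-- The operator system `C(S¹)^{(n)}` of `n × n` complex Toeplitz matrices `[τ_{i-j}]`. -/
def toeplitzSystem (n : ℕ) : MatrixOperatorSystem n where
  space :=
    { carrier := {A | ∃ τ : ℤ → ℂ, ∀ i j : Fin n, A i j = τ ((i : ℤ) - (j : ℤ))}
      add_mem' := by
        rintro A B ⟨σ, hσ⟩ ⟨τ, hτ⟩
        exact ⟨σ + τ, fun i j => by simp [hσ, hτ]⟩
      zero_mem' := ⟨0, fun i j => by simp⟩
      smul_mem' := by
        rintro c A ⟨τ, hτ⟩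
        exact ⟨c • τ, fun i j => by simp [hτ]⟩ }
  one_mem := by
    refine ⟨fun k => if k = 0 then 1 else 0, fun i j => ?_⟩
    simp [Matrix.one_apply, sub_eq_zero, Fin.ext_iff]
  conjTranspose_mem := by
    rintro A ⟨τ, hτ⟩
    exact ⟨fun k => star (τ (-k)), fun i j => by simp [Matrix.conjTranspose_apply, hτ]⟩

/-! The margin in strict positivity absorbs the `ε` of the maximal cone, so `x = δ* (a ⊗ b) δ`
exactly. It remains to split `a` as `∑ t, c_t* c_t ⊗ r_t` with `r_t` positive Toeplitz; the scalar
vectors `c_t` then move onto `b`, whose compressions are positive. Only `a` has to be Toeplitz. For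
the splitting, write `a` as the Gram matrix of vectors `w (p, i)`. Block Toeplitz means that the
shift `i ↦ i + 1` preserves inner products, so it is implemented by an isometry `U` of a
finite-dimensional space. In an orthonormal eigenbasis of `U`, each coordinate of `w (p, i)` is `ev
^ i` times that of `w (p, 0)`, and Parseval gives the sum. -/

/-- A linear isometry of a finite-dimensional complex inner product space into itself admits an
orthonormal basis of eigenvectors. -/
theorem LinearIsometry.exists_orthonormalBasis_eigenvectors {E : Type*} [NormedAddCommGroup E]
    [InnerProductSpace ℂ E] [FiniteDimensional ℂ E] (U : E →ₗᵢ[ℂ] E) :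
    ∃ (b : OrthonormalBasis (Fin (Module.finrank ℂ E)) ℂ E)
      (ev : Fin (Module.finrank ℂ E) → ℂ),
      (∀ i, U (b i) = ev i • b i) ∧ ∀ i, star (ev i) * ev i = 1 := by
  classical
  have hunit : ∀ (μ : ℂ) (u : E), U u = μ • u → u ≠ 0 → star μ * μ = 1 := by
    intro μ u hu h0
    have h : ‖μ‖ * ‖u‖ = ‖u‖ := by rw [← norm_smul, ← hu, U.norm_map]
    have h1 : ‖μ‖ = 1 := (mul_eq_right₀ (norm_ne_zero_iff.mpr h0)).mp h
    have := Complex.conj_mul' μ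
    rw [h1] at this
    simpa using this
  have horth : ∀ (μ ν : ℂ) (u v : E), U u = μ • u → U v = ν • v → μ ≠ ν → inner ℂ u v = 0 := by
    intro μ ν u v hu hv hne
    by_contra h
    have hu0 : u ≠ 0 := by rintro rfl; simp at h
    have h1 : star μ * ν * inner ℂ u v = inner ℂ u v := by
      conv_rhs => rw [← U.inner_map_map u v, hu, hv, inner_smul_left, inner_smul_right,
        starRingEnd_apply]
      ring
    have h2 : star μ * ν = 1 := (mul_eq_right₀ h).mp h1
    have h3 := hunit μ u hu hu0
    have h4 : star μ ≠ 0 := by rintro h; simp [h] at h3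
    exact hne (mul_left_cancel₀ h4 (h3.trans h2.symm))
  let T : Module.End ℂ E := U.toLinearMap
  have hT : ∀ (μ : ℂ) (u : E), u ∈ T.eigenspace μ ↔ U u = μ • u := fun μ u =>
    Module.End.mem_eigenspace_iff
  have hfam : OrthogonalFamily ℂ (fun μ : T.Eigenvalues => T.eigenspace (μ : ℂ))
      fun μ => (T.eigenspace (μ : ℂ)).subtypeₗᵢ := by
    intro μ ν hne u v
    exact horth μ ν u v ((hT _ _).mp u.2) ((hT _ _).mp v.2) fun h => hne (Subtype.ext h)
  have hint : DirectSum.IsInternal fun μ : T.Eigenvalues => T.eigenspace (μ : ℂ) := by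
    rw [hfam.isInternal_iff, ← Submodule.iInf_orthogonal]
    set W : Submodule ℂ E := ⨅ μ : T.Eigenvalues, (T.eigenspace (μ : ℂ))ᗮ with hW
    -- For `U u = μ u` and `x ⊥ u`, `conj μ * ⟪u, U x⟫ = ⟪U u, U x⟫ = ⟪u, x⟫ = 0`, and `μ ≠ 0`.
    have hinv : ∀ x ∈ W, T x ∈ W := by
      intro x hx
      simp only [hW, Submodule.mem_iInf, Submodule.mem_orthogonal] at hx ⊢
      intro μ u hu
      have hu' := (hT _ _).mp hu
      by_cases hu0 : u = 0
      · simp [hu0]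
      have h1 : star (μ : ℂ) * inner ℂ u (U x) = 0 := by
        rw [← hx μ u hu, ← U.inner_map_map u x, hu', inner_smul_left]
        simp
      have h3 := hunit μ u hu' hu0
      refine (mul_eq_zero.mp h1).resolve_left fun h => ?_
      simp [h] at h3
    by_contra hne
    have : Nontrivial W := Submodule.nontrivial_iff_ne_bot.mpr hne
    -- An eigenvector inside `W` would be orthogonal to its own eigenspace, hence to itself.
    obtain ⟨μ, hμ⟩ := Module.End.exists_eigenvalue (T.restrict hinv)
    obtain ⟨v, hv⟩ := hμ.exists_hasEigenvector
    have hv1 : (v : E) ∈ T.eigenspace μ :=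
      (hT _ _).mpr (congrArg Subtype.val hv.apply_eq_smul)
    have hv0 : (v : E) ≠ 0 := fun h => hv.2 (Subtype.ext h)
    have hμ' : T.HasEigenvalue μ := Module.End.hasEigenvalue_of_hasEigenvector ⟨hv1, hv0⟩
    have hvW := v.2
    simp only [hW, Submodule.mem_iInf, Submodule.mem_orthogonal] at hvW
    exact hv0 (inner_self_eq_zero.mp (hvW ⟨μ, hμ'⟩ v hv1))
  refine ⟨hint.subordinateOrthonormalBasis rfl hfam,
    fun i => ((hint.subordinateOrthonormalBasisIndex rfl i hfam : T.Eigenvalues) : ℂ), ?_⟩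
  have key : ∀ i, U (hint.subordinateOrthonormalBasis rfl hfam i) =
      ((hint.subordinateOrthonormalBasisIndex rfl i hfam : T.Eigenvalues) : ℂ) •
        hint.subordinateOrthonormalBasis rfl hfam i := fun i =>
    (hT _ _).mp (hint.subordinateOrthonormalBasis_subordinate rfl i hfam)
  exact ⟨key, fun i => hunit _ _ (key i) ((OrthonormalBasis.orthonormal _).ne_zero i)⟩

/-- Two families of vectors with the same Gram matrix in a finite-dimensional inner product space
are intertwined by a linear isometry of the whole space. -/
theorem LinearIsometry.exists_of_inner_eq {E ι : Type*} [NormedAddCommGroup E]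
    [InnerProductSpace ℂ E] [FiniteDimensional ℂ E] [Fintype ι] (v w : ι → E)
    (h : ∀ i j, inner ℂ (v i) (v j) = inner ℂ (w i) (w j)) :
    ∃ U : E →ₗᵢ[ℂ] E, ∀ i, U (v i) = w i := by
  classical
  let F : (ι → ℂ) →ₗ[ℂ] E := Fintype.linearCombination ℂ v
  let G : (ι → ℂ) →ₗ[ℂ] E := Fintype.linearCombination ℂ w
  have hnorm : ∀ c, ‖F c‖ = ‖G c‖ := by
    intro c
    have : inner ℂ (F c) (F c) = inner ℂ (G c) (G c) := by
      simp only [F, G, Fintype.linearCombination_apply, sum_inner, inner_sum, inner_smul_left,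
        inner_smul_right, h]
    rw [norm_eq_sqrt_re_inner (𝕜 := ℂ), this, ← norm_eq_sqrt_re_inner]
  obtain ⟨s, hs⟩ := F.rangeRestrict.exists_rightInverse_of_surjective F.range_rangeRestrict
  have hs' : ∀ y : F.range, F (s y) = y := fun y =>
    congrArg Subtype.val (LinearMap.congr_fun hs y)
  let L : F.range →ₗᵢ[ℂ] E :=
    ⟨G ∘ₗ s, fun y => by
      rw [LinearMap.comp_apply, ← hnorm, hs', Submodule.coe_norm]⟩
  -- Independent of the section `s`: by `hnorm`, `F` and `G` have the same kernel.
  have hL : ∀ c, L ⟨F c, c, rfl⟩ = G c := by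
    intro c
    rw [← sub_eq_zero]
    change G (s ⟨F c, c, rfl⟩) - G c = 0
    rw [← map_sub, ← norm_eq_zero, ← hnorm, map_sub, hs']
    simp
  refine ⟨L.extend, fun i => ?_⟩
  have hF : F (Pi.single i 1) = v i := by simp [F, Fintype.linearCombination_apply_single]
  have hG : G (Pi.single i 1) = w i := by simp [G, Fintype.linearCombination_apply_single]
  rw [← hF, ← hG, ← hL]
  exact L.extend_apply ⟨F (Pi.single i 1), _, rfl⟩

/-- A positive semidefinite matrix is a Gram matrix. -/
theorem Matrix.PosSemidef.exists_gram {ι : Type*} [Finite ι] {M : Matrix ι ι ℂ}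
    (hM : M.PosSemidef) :
    ∃ (d : ℕ) (w : ι → EuclideanSpace ℂ (Fin d)), ∀ i j, M i j = inner ℂ (w i) (w j) := by
  obtain ⟨d, v, hv⟩ := Matrix.posSemidef_iff_eq_sum_vecMulVec.mp hM
  refine ⟨d, fun i => WithLp.toLp 2 fun t => star (v t i), fun i j => ?_⟩
  simp [hv, Matrix.sum_apply, Matrix.vecMulVec_apply, PiLp.inner_apply, mul_comm]

/-- A positive semidefinite block Toeplitz matrix is a sum of elementary tensors of rank one
positive semidefinite Toeplitz matrices and rank one positive semidefinite matrices. -/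
theorem exists_sum_of_posSemidef_blockToeplitz {κ : Type*} [Fintype κ] {n : ℕ}
    (τ : κ → κ → ℤ → ℂ)
    (h : (Matrix.of fun x y : κ × Fin n => τ x.1 y.1 ((x.2 : ℤ) - (y.2 : ℤ))).PosSemidef) :
    ∃ (d : ℕ) (ev : Fin d → ℂ) (c : Fin d → κ → ℂ), (∀ t, star (ev t) * ev t = 1) ∧
      ∀ p q (i j : Fin n), τ p q ((i : ℤ) - (j : ℤ)) =
        ∑ t, (star (c t p) * c t q) * (star (ev t) ^ (i : ℕ) * ev t ^ (j : ℕ)) := by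
  -- The index `0` used below as base point exists only for positive size.
  obtain _ | n := n
  · exact ⟨0, 0, 0, fun t => t.elim0, fun _ _ i => i.elim0⟩
  obtain ⟨D, w, hw⟩ := h.exists_gram
  replace hw : ∀ p q (i j : Fin (n + 1)),
      τ p q ((i : ℤ) - (j : ℤ)) = inner ℂ (w (p, i)) (w (q, j)) :=
    fun p q i j => hw (p, i) (q, j)
  -- Raising both indices by one leaves `i - j` unchanged, so the Gram matrices agree.
  obtain ⟨U, hU⟩ := LinearIsometry.exists_of_inner_eq
    (fun x : κ × Fin n => w (x.1, x.2.castSucc)) (fun x => w (x.1, x.2.succ)) (by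
      intro x y
      rw [← hw, ← hw]
      simp)
  obtain ⟨b, ev, hb, hev⟩ := U.exists_orthonormalBasis_eigenvectors
  have hstep : ∀ t v, inner ℂ (b t) (U v) = ev t * inner ℂ (b t) v := by
    intro t v
    rw [← U.inner_map_map (b t) v, hb, inner_smul_left, ← mul_assoc, starRingEnd_apply,
      mul_comm (ev t), hev, one_mul]
  have hpow : ∀ t p (i : Fin (n + 1)),
      inner ℂ (b t) (w (p, i)) = ev t ^ (i : ℕ) * inner ℂ (b t) (w (p, 0)) := by
    intro t p i
    induction i using Fin.induction with
    | zero => simp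
    | succ i ih =>
      rw [← hU (p, i), hstep, ih, Fin.val_succ, pow_succ', mul_assoc]
      rfl
  refine ⟨_, ev, fun t p => inner ℂ (b t) (w (p, 0)), hev, fun p q i j => ?_⟩
  rw [hw, ← b.sum_inner_mul_inner]
  refine Finset.sum_congr rfl fun t _ => ?_
  rw [← inner_conj_symm, hpow t p i, hpow t q j, starRingEnd_apply, star_mul', star_pow]
  ring

/-- The rank one Toeplitz matrix with entries `conj z ^ i * z ^ j`, for `z` on the unit circle. -/
def toeplitzCharacter (n : ℕ) (z : ℂ) (hz : star z * z = 1) : (toeplitzSystem n).space :=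
  ⟨Matrix.of fun i j => star z ^ (i : ℕ) * z ^ (j : ℕ), fun k => z ^ (-k), fun i j => by
    have h0 : z ≠ 0 := by rintro rfl; simp at hz
    change star z ^ (i : ℕ) * z ^ (j : ℕ) = z ^ (-((i : ℤ) - (j : ℤ)))
    rw [eq_inv_of_mul_eq_one_left hz, neg_sub, zpow_sub₀ h0, zpow_natCast,
      zpow_natCast, inv_pow, div_eq_inv_mul]⟩

theorem toeplitzCharacter_isPositive (n : ℕ) (z : ℂ) (hz : star z * z = 1) :
    (toeplitzSystem n).IsPositive (toeplitzCharacter n z hz) := by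
  have h := Matrix.posSemidef_vecMulVec_star_self fun i : Fin n => z ^ (i : ℕ)
  unfold MatrixOperatorSystem.IsPositive
  convert h using 1
  ext i j
  simp [toeplitzCharacter, Matrix.vecMulVec_apply]

/-- The matrix cones of the Toeplitz system are separable. -/
theorem toeplitzSystem_isMatrixPositive_exists_sum {n k : ℕ}
    {a : Matrix (Fin k) (Fin k) (toeplitzSystem n).space}
    (ha : (toeplitzSystem n).IsMatrixPositive a) :
    ∃ (d : ℕ) (r : Fin d → (toeplitzSystem n).space) (c : Fin d → Fin k → ℂ),
      (∀ t, (toeplitzSystem n).IsPositive (r t)) ∧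
        ∀ p q, a p q = ∑ t, (star (c t p) * c t q) • r t := by
  choose τ hτ using fun p q => (a p q).2
  obtain ⟨d, ev, c, hev, hc⟩ := exists_sum_of_posSemidef_blockToeplitz (n := n) τ (by
    unfold MatrixOperatorSystem.IsMatrixPositive at ha
    convert ha using 1
    ext x y
    exact (hτ x.1 y.1 x.2 y.2).symm)
  refine ⟨d, fun t => toeplitzCharacter n (ev t) (hev t), c,
    fun t => toeplitzCharacter_isPositive _ _ _, fun p q => ?_⟩
  ext i j
  rw [hτ, hc]
  simp [Matrix.sum_apply, toeplitzCharacter]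

namespace MatrixOperatorSystem

/-- Compressing a positive matrix over an operator system by a scalar vector gives a positive
element. -/
theorem IsMatrixPositive.isPositive_sum {m q : ℕ} {T : MatrixOperatorSystem m}
    {b : Matrix (Fin q) (Fin q) T.space} (hb : T.IsMatrixPositive b) (c : Fin q → ℂ) :
    T.IsPositive (∑ k, ∑ l, (star (c k) * c l) • b k l) := by
  -- `B` is the block column `c ⊗ 1_m`, so `Bᴴ * b * B` is the required sum.
  let B : Matrix (Fin q × Fin m) (Fin m) ℂ := Matrix.of fun x j => if x.2 = j then c x.1 else 0
  have h := hb.conjTranspose_mul_mul_same B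
  unfold IsPositive
  convert h using 1
  ext i j
  simp only [B, Matrix.mul_apply, Matrix.conjTranspose_apply, Fintype.sum_prod_type,
    Matrix.of_apply, Matrix.comp_apply, Matrix.map_apply]
  simp [Matrix.sum_apply, Finset.sum_mul, apply_ite]
  rw [Finset.sum_comm]
  refine Finset.sum_congr rfl fun k _ => Finset.sum_congr rfl fun l _ => ?_
  ring

end MatrixOperatorSystem

theorem propositionl1 (n m : ℕ) (x : (toeplitzSystem n).space ⊗[ℂ] (toeplitzSystem m).space)
    (hx : MatrixOperatorSystem.IsMaxStrictlyPositive (toeplitzSystem n) (toeplitzSystem m) x) :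
    MatrixOperatorSystem.IsMaxSeparable (toeplitzSystem n) (toeplitzSystem m) x := by
  obtain ⟨hpos, ε, hε, hstrict⟩ := hx
  refine ⟨hpos, ?_⟩
  -- With tolerance equal to the margin, the two multiples of the unit cancel.
  obtain ⟨k, q, a, b, δ, ha, hb, hab⟩ := hstrict ε hε
  have hx : x = ∑ y : Fin k × Fin q, ∑ z : Fin k × Fin q,
      (star (δ y 0) * δ z 0) • (a y.1 z.1 ⊗ₜ[ℂ] b y.2 z.2) := by
    have := congrFun (congrFun hab 0) 0
    simpa [MatrixOperatorSystem.compress, MatrixOperatorSystem.matrixTmul] using this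
  obtain ⟨d, r, c, hr, hc⟩ := toeplitzSystem_isMatrixPositive_exists_sum ha
  -- `v t` contracts the first leg of `δ` against `c t`, leaving a vector that compresses `b`.
  let v : Fin d → Fin q → ℂ := fun t l => ∑ p, c t p * δ (p, l) 0
  refine ⟨d, r, fun t => ∑ l, ∑ l', (star (v t l) * v t l') • b l l', hr,
    fun t => hb.isPositive_sum (v t), ?_⟩
  have hsum : ∀ f : Fin k → Fin q → Fin k → Fin q → Fin d →
      (toeplitzSystem n).space ⊗[ℂ] (toeplitzSystem m).space,
      ∑ p, ∑ l, ∑ p', ∑ l', ∑ t, f p l p' l' t = ∑ t, ∑ l, ∑ l', ∑ p, ∑ p', f p l p' l' t := by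
    intro f
    have := Fintype.sum_equiv
      (⟨fun y => (y.2.2.2.2, y.2.1, y.2.2.2.1, y.1, y.2.2.1),
        fun y => (y.2.2.2.1, y.2.1, y.2.2.2.2, y.2.2.1, y.1), fun _ => rfl, fun _ => rfl⟩ :
        Fin k × Fin q × Fin k × Fin q × Fin d ≃ Fin d × Fin q × Fin q × Fin k × Fin k)
      (fun y => f y.1 y.2.1 y.2.2.1 y.2.2.2.1 y.2.2.2.2)
      (fun y => f y.2.2.2.1 y.2.1 y.2.2.2.2 y.2.2.1 y.1) fun _ => rfl
    simpa only [Fintype.sum_prod_type] using this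
  rw [hx]
  simp only [hc, v, star_sum, Finset.sum_mul_sum, Finset.sum_smul, TensorProduct.sum_tmul,
    TensorProduct.tmul_sum, Finset.smul_sum, TensorProduct.smul_tmul', TensorProduct.tmul_smul,
    smul_smul, Fintype.sum_prod_type, star_mul']
  rw [hsum]
  refine Finset.sum_congr rfl fun t _ => Finset.sum_congr rfl fun l _ => Finset.sum_congr rfl
    fun l' _ => Finset.sum_congr rfl fun p _ => Finset.sum_congr rfl fun p' _ => ?_
  congr 2
  ring
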